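/- **Lifting for multi-output $k$-search games.** Let $X$ be a finite set, let $Y$ be a finite abelian group, and let $k,q\ge 0$ be integers. A *multi-output $k$-search game* $\mathcal G$ over a uniformly random oracle $H:X\to Y$ is given by a (discrete) distribution $\pi$ over challenges, independent of $H$, and, for each challenge $ch$, a relation $R_{ch}\subseteq X^k\times Y^k\times Z$. The challenger samples $ch\leftarrow\pi$ and sends it to an adversary, who has quantum access to $H$ and outputs $(x_1,\dots,x_k)\in X^k$ and $z\in Z$. The challenger queries $H$ classically at $x_1,\dots,x_k$, and the adversary wins if and only if $$\big((x_1,\dots,x_k),\,(H(x_1),\dots,H(x_k)),\,z\big)\in R_{ch}.$$ A *$q$-quantum query adversary* acts on a finite-dimensional space with basis states $|x,y,w\rangle$, where $x\in X$, $y\in Y$ and $w$ ranges over a finite set of its choice. It starts in a fixed basis state and applies $U_q\,O_H\,U_{q-1}\cdots O_H\,U_0$, where $O_H|x,y,w\rangle=|x,y+H(x),w\rangle$ and the unitaries $U_i$ may depend on $ch$ but not on $H$. It then measures in this basis and obtains its output as a function of the result and $ch$. Then for every multi-output $k$-search game $\mathcal G$ and every $q$-quantum query adversary $\mathcal A$ there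 is a $k$-quantum query adversary $\mathcal B$ such that $$\Pr\big[\mathcal B^{|H\rangle}\text{ wins }\mathcal G\big]\;\ge\;\frac{1}{2^{2k}\binom{q+k}{k}^2}\;\Pr\big[\mathcal A^{|H\rangle}\text{ wins }\mathcal G\big],$$ where both probabilities are over the uniformly random oracle $H$, the challenge, and the measurement of the adversary. -/

import Mathlib

universe u v w

namespace QROM

/-- The quantum oracle query to `H`, acting on the state space with orthonormal basis
`|x, y, w⟩` (query register, answer register, work register); it is the unitary
`O_H |x, y, w⟩ = |x, y + H x, w⟩`, given here through the amplitudes of a vector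
(see `oracleQuery_single`). The group operation of `Y` plays the role of `⊕`. -/
def oracleQuery {X Y W : Type u} [AddCommGroup Y] (H : X → Y) (ψ : X × Y × W → ℂ) :
    X × Y × W → ℂ :=
  fun s => ψ (s.1, s.2.1 - H s.1, s.2.2)

theorem oracleQuery_single {X Y W : Type u} [AddCommGroup Y]
    [DecidableEq X] [DecidableEq Y] [DecidableEq W] (H : X → Y) (x : X) (y : Y) (w : W) :
    oracleQuery H (Pi.single (x, y, w) 1 : X × Y × W → ℂ) = Pi.single (x, y + H x, w) 1 := by
  funext s
  obtain ⟨a, b, c⟩ := s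
  have h : ((a, b - H a, c) = (x, y, w)) ↔ ((a, b, c) = (x, y + H x, w)) := by
    constructor
    · intro h
      simp only [Prod.mk.injEq] at h ⊢
      obtain ⟨rfl, h2, h3⟩ := h
      exact ⟨rfl, sub_eq_iff_eq_add.mp h2, h3⟩
    · intro h
      simp only [Prod.mk.injEq] at h ⊢
      obtain ⟨rfl, h2, h3⟩ := h
      exact ⟨rfl, sub_eq_iff_eq_add.mpr h2, h3⟩
  simp only [oracleQuery, Pi.single_apply, h]

/-- A multi-output `k`-search game relative to a random oracle `X → Y`: a distribution of
challenges, and for each challenge `ch` a relation on `X ^ k × Y ^ k × Z`. The challenger accepts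
an answer `(x, z)` when `rel ch x y z` holds for `y i = H (x i)`; these `k` values are all it
learns about the oracle. -/
structure SearchGame (X Y : Type u) (Ch : Type v) (Z : Type w) (k : ℕ) where
  challenge : PMF Ch
  rel : Ch → (Fin k → X) → (Fin k → Y) → Z → Prop

/-- A quantum adversary making `q` oracle queries: it receives a challenge `ch : Ch` and
outputs an element of `Out`. Started in the basis state `|start⟩`, it applies
`U 0`, a query, `U 1`, a query, ..., a query, `U q`. These unitaries do not depend on the
oracle. At the end all registers are measured in the computational basis, and the output
is read off from the result. -/
structure QuantumAdversary (X Y : Type u) (Ch : Type v) (Out : Type w) (q : ℕ)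
    [Fintype X] [DecidableEq X] [Fintype Y] [DecidableEq Y] where
  /-- basis of the work register -/
  Work : Type u
  [fintypeWork : Fintype Work]
  [decidableEqWork : DecidableEq Work]
  start : X × Y × Work
  U : Ch → Fin (q + 1) → Matrix.unitaryGroup (X × Y × Work) ℂ
  readout : Ch → X × Y × Work → Out

attribute [instance] QuantumAdversary.fintypeWork QuantumAdversary.decidableEqWork

section

variable {X Y : Type u} {Ch : Type v} [Fintype X] [DecidableEq X]
  [Fintype Y] [DecidableEq Y] [AddCommGroup Y]

/-- The state on challenge `ch` with oracle `H`, after `i` queries and the unitary `U i`. -/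
noncomputable def QuantumAdversary.state {Out : Type w} {q : ℕ}
    (A : QuantumAdversary X Y Ch Out q) (ch : Ch) (H : X → Y) :
    Fin (q + 1) → (X × Y × A.Work → ℂ) :=
  Fin.induction (motive := fun _ => X × Y × A.Work → ℂ)
    ((A.U ch 0).1.mulVec (Pi.single A.start 1))
    (fun i ψ => (A.U ch i.succ).1.mulVec (oracleQuery H ψ))

open Classical in
/-- The probability that, on challenge `ch` with oracle `H`, the output satisfies `P`. -/
noncomputable def QuantumAdversary.prob {Out : Type w} {q : ℕ}
    (A : QuantumAdversary X Y Ch Out q) (ch : Ch) (H : X → Y) (P : Out → Prop) : ℝ :=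
  ∑ s : X × Y × A.Work, if P (A.readout ch s) then ‖A.state ch H (Fin.last q) s‖ ^ 2 else 0

/-- The probability that the adversary wins the game, over a uniformly random oracle
`H : X → Y`, the challenge, and the adversary's measurement. -/
noncomputable def SearchGame.winProb {Z : Type w} {k q : ℕ} (G : SearchGame X Y Ch Z k)
    (A : QuantumAdversary X Y Ch ((Fin k → X) × Z) q) : ℝ :=
  (Fintype.card (X → Y) : ℝ)⁻¹ * ∑ H : X → Y, ∑' ch : Ch, (G.challenge ch).toReal *
    A.prob ch H (fun o => G.rel ch o.1 (fun i => H (o.1 i)) o.2)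

end

end QROM

/-!
Fix the challenge and a basis state `s` in which the adversary `A` may end, and let `S` be the set
of the at most `k` oracle inputs occurring in the output read off from `s`. A uniformly random
oracle can be written as `S.piecewise H H'` with `H` and `H'` independent and uniform
(`sum_sum_piecewise`), and whether `s` wins then depends on `H` only. So it suffices to reproduce,
with `k` queries to `H`, the amplitude of `s` in the run of `A` with the oracle `S.piecewise H H'`,
where `H'` is known.

Answer the queries of `A` from `H'`, and let a query whose input `x` lies in `S` and is met there
for the first time be corrected by the term (answer from `H`) - (answer from `H'`), after which `x`
is recorded and answered from `H`. This telescopes to an exact expansion of the state of `A`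
(`evolve_piecewise`) into signed terms `branch p T`. The pattern `p` says which queries record their
input, and which of the two signed answers each of these receives; `T ⊆ S` is the set of recorded
inputs. The order in which the elements of `T` were recorded is summed over *coherently* within one
branch; if each order were a branch of its own, their number would grow by a factor of up to `k!`.
Since `T` has as many elements as `p` has recordings, the number of branches is at most
`∑ p, k.choose (recordings p) ≤ 2 ^ k * (q + k).choose k` (`sum_choose_recordings_le`), and the
Cauchy-Schwarz inequality bounds the probability of `s` by this number times the sum of the squared
branches (`norm_sq_evolve_piecewise_le`).

For fixed `H'` and `p` with at most `k` recordings, all branches are produced by one circuit with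
`recordings p` queries: it keeps `T` and the values of `H` on `T` in registers, so that branches
with different `T` are orthogonal and the order of recording is forgotten (`recordState_eq_branch`).
A unitary has to act on inputs that are already recorded, too: these are removed from `T`, and the
size of `T` in the end tells whether this ever happened. The number of patterns is again at most
`2 ^ k * (q + k).choose k`, so some pair of an `H'` and a pattern attains the average over all of
them, which gives the second factor of the loss.
-/

namespace QROM

open Finset Matrix

/-! ### Circuits with oracle queries -/

section Evolution

variable {X Y W : Type u} [Fintype X] [DecidableEq X] [Fintype Y] [DecidableEq Y]
  [AddCommGroup Y] [Fintype W] [DecidableEq W] {Ch : Type v}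

/-- The state after `V 0`, a query, `V 1`, a query, ..., a query, `V n`, started in `ψ`. -/
noncomputable def evolve (V : ℕ → unitaryGroup (X × Y × W) ℂ) (ψ : X × Y × W → ℂ)
    (H : X → Y) : ℕ → X × Y × W → ℂ
  | 0 => (V 0).1 *ᵥ ψ
  | n + 1 => (V (n + 1)).1 *ᵥ oracleQuery H (evolve V ψ H n)

theorem evolve_congr {V V' : ℕ → unitaryGroup (X × Y × W) ℂ} (ψ : X × Y × W → ℂ)
    (H : X → Y) {n : ℕ} (h : ∀ i ≤ n, V i = V' i) : evolve V ψ H n = evolve V' ψ H n := by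
  induction n with
  | zero => simp only [evolve, h 0 le_rfl]
  | succ n ih => simp only [evolve, h (n + 1) le_rfl, ih fun i hi => h i (by omega)]

theorem QuantumAdversary.state_eq_evolve {Out : Type w} {q : ℕ}
    (A : QuantumAdversary X Y Ch Out q) (ch : Ch) (H : X → Y) (i : Fin (q + 1)) :
    A.state ch H i =
      evolve (fun n => A.U ch (Fin.ofNat (q + 1) n)) (Pi.single A.start 1) H i := by
  induction i using Fin.induction with
  | zero => rfl
  | succ i ih =>
    have h : Fin.ofNat (q + 1) (i.1 + 1) = i.succ := by
      ext
      simp [Fin.ofNat, Nat.mod_eq_of_lt]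
    have e : A.state ch H i.succ =
        (A.U ch i.succ).1 *ᵥ oracleQuery H (A.state ch H i.castSucc) := rfl
    rw [e, ih]
    simp only [Fin.val_succ, Fin.val_castSucc, evolve, h]

theorem sum_norm_sq_mulVec {n : Type*} [Fintype n] [DecidableEq n] (U : unitaryGroup n ℂ)
    (ψ : n → ℂ) : ∑ s, ‖(U.1 *ᵥ ψ) s‖ ^ 2 = ∑ s, ‖ψ s‖ ^ 2 := by
  have key : ∀ φ : n → ℂ, ((∑ s, ‖φ s‖ ^ 2 : ℝ) : ℂ) = star φ ⬝ᵥ φ := fun φ => by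
    simp [dotProduct, Complex.conj_mul']
  have hU : U.1ᴴ * U.1 = 1 := (mem_unitaryGroup_iff' (A := U.1)).1 U.2
  apply Complex.ofReal_injective
  rw [key, key, star_mulVec, ← dotProduct_mulVec, mulVec_mulVec, hU, one_mulVec]

omit [DecidableEq X] [DecidableEq Y] [DecidableEq W] in
/-- A query only permutes the values of the answer register. -/
theorem sum_oracleQuery (H : X → Y) (ψ : X × Y × W → ℂ) (F : X → W → ℂ → ℝ) :
    ∑ s : X × Y × W, F s.1 s.2.2 (oracleQuery H ψ s) = ∑ s : X × Y × W, F s.1 s.2.2 (ψ s) := by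
  simp only [Fintype.sum_prod_type, oracleQuery]
  exact sum_congr rfl fun x _ =>
    (Equiv.subRight (H x)).sum_comp fun y => ∑ w, F x w (ψ (x, y, w))

theorem sum_norm_sq_evolve (V : ℕ → unitaryGroup (X × Y × W) ℂ) (ψ : X × Y × W → ℂ)
    (H : X → Y) (n : ℕ) : ∑ s, ‖evolve V ψ H n s‖ ^ 2 = ∑ s, ‖ψ s‖ ^ 2 := by
  induction n with
  | zero => exact sum_norm_sq_mulVec _ _
  | succ n ih =>
    rw [evolve, sum_norm_sq_mulVec, ← ih]
    exact sum_oracleQuery H _ fun _ _ c => ‖c‖ ^ 2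

theorem QuantumAdversary.prob_nonneg {Out : Type w} {q : ℕ}
    (A : QuantumAdversary X Y Ch Out q) (ch : Ch) (H : X → Y) (P : Out → Prop) :
    0 ≤ A.prob ch H P :=
  sum_nonneg fun s _ => by split_ifs <;> positivity

theorem QuantumAdversary.prob_le_one {Out : Type w} {q : ℕ}
    (A : QuantumAdversary X Y Ch Out q) (ch : Ch) (H : X → Y) (P : Out → Prop) :
    A.prob ch H P ≤ 1 := by
  calc A.prob ch H P ≤ ∑ s, ‖A.state ch H (Fin.last q) s‖ ^ 2 :=
        sum_le_sum fun s _ => by split_ifs <;> simp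
    _ = ∑ s, ‖(Pi.single A.start 1 : X × Y × A.Work → ℂ) s‖ ^ 2 := by
        rw [A.state_eq_evolve, sum_norm_sq_evolve]
    _ = 1 := by
        rw [Fintype.sum_eq_single A.start fun s hs => by simp [hs]]
        simp

/-- `Realizable k Ψ` says that the states `Ψ ch H` are those of a circuit with `k` oracle queries,
started in a basis state, whose unitaries depend on the challenge but not on the oracle. -/
def Realizable (k : ℕ) (Ψ : Ch → (X → Y) → X × Y × W → ℂ) : Prop :=
  ∃ (start : X × Y × W) (V : Ch → ℕ → unitaryGroup (X × Y × W) ℂ),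
    ∀ ch H, Ψ ch H = evolve (V ch) (Pi.single start 1) H k

theorem realizable_single (start : X × Y × W) :
    Realizable 0 fun (_ : Ch) (_ : X → Y) => (Pi.single start 1 : X × Y × W → ℂ) :=
  ⟨start, fun _ _ => 1, fun _ _ => by simp only [evolve, OneMemClass.coe_one, one_mulVec]⟩

theorem Realizable.mulVec {k : ℕ} {Ψ : Ch → (X → Y) → X × Y × W → ℂ} (h : Realizable k Ψ)
    (U : Ch → unitaryGroup (X × Y × W) ℂ) :
    Realizable k fun ch H => (U ch).1 *ᵥ Ψ ch H := by
  obtain ⟨start, V, hV⟩ := h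
  refine ⟨start, fun ch => Function.update (V ch) k (U ch * V ch k), fun ch H => ?_⟩
  dsimp only
  rw [hV]
  cases k with
  | zero => simp only [evolve, Function.update_self, Submonoid.coe_mul, mulVec_mulVec]
  | succ k =>
    have e := evolve_congr (V := V ch)
      (V' := Function.update (V ch) (k + 1) (U ch * V ch (k + 1))) (Pi.single start 1) H (n := k)
      fun i hi => by rw [Function.update_of_ne (by omega)]
    simp [evolve, e]

theorem Realizable.query {k : ℕ} {Ψ : Ch → (X → Y) → X × Y × W → ℂ} (h : Realizable k Ψ) :
    Realizable (k + 1) fun ch H => oracleQuery H (Ψ ch H) := by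
  obtain ⟨start, V, hV⟩ := h
  refine ⟨start, fun ch => Function.update (V ch) (k + 1) 1, fun ch H => ?_⟩
  have e := evolve_congr (V := V ch) (V' := Function.update (V ch) (k + 1) 1)
    (Pi.single start 1) H (n := k) fun i hi => by rw [Function.update_of_ne (by omega)]
  simp [evolve, hV, e]

theorem Realizable.perm {k : ℕ} {Ψ : Ch → (X → Y) → X × Y × W → ℂ} (h : Realizable k Ψ)
    (e : Equiv.Perm (X × Y × W)) : Realizable k fun ch H s => Ψ ch H (e s) := by
  have hU : (1 : Matrix (X × Y × W) (X × Y × W) ℂ).submatrix e id ∈ unitaryGroup _ ℂ := by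
    rw [mem_unitaryGroup_iff, star_eq_conjTranspose, conjTranspose_submatrix, conjTranspose_one,
      submatrix_mul _ _ e id e Function.bijective_id |>.symm, one_mul, submatrix_one_equiv]
  convert h.mulVec fun _ => ⟨_, hU⟩ using 4 with ch H s
  simp [Matrix.mulVec, dotProduct, Matrix.one_apply]

/-- Further queries are harmless: each one only permutes the values of the answer register. -/
theorem Realizable.pad {j k : ℕ} (hjk : j ≤ k) {Ψ : Ch → (X → Y) → X × Y × W → ℂ}
    (h : Realizable j Ψ) : ∃ Ψ' : Ch → (X → Y) → X × Y × W → ℂ, Realizable k Ψ' ∧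
      ∀ ch H (F : X → W → ℂ → ℝ),
        ∑ s : X × Y × W, F s.1 s.2.2 (Ψ' ch H s) = ∑ s : X × Y × W, F s.1 s.2.2 (Ψ ch H s) := by
  induction k, hjk using Nat.le_induction with
  | base => exact ⟨Ψ, h, fun _ _ _ => rfl⟩
  | succ k _ ih =>
    obtain ⟨Ψ', h', hF⟩ := ih
    exact ⟨_, h'.query, fun ch H F => (sum_oracleQuery H _ F).trans (hF ch H F)⟩

open Classical in
/-- A circuit with `j ≤ k` queries gives a `k`-query adversary, with the same distribution of
outputs as long as these do not depend on the answer register. -/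
theorem Realizable.exists_adversary {Out : Type w} {j k : ℕ} (hjk : j ≤ k)
    {Ψ : Ch → (X → Y) → X × Y × W → ℂ} (h : Realizable j Ψ) (r : Ch → X → W → Out) :
    ∃ B : QuantumAdversary X Y Ch Out k, ∀ ch H P, B.prob ch H P =
      ∑ s : X × Y × W, if P (r ch s.1 s.2.2) then ‖Ψ ch H s‖ ^ 2 else 0 := by
  obtain ⟨Ψ', ⟨start, V, hV⟩, hF⟩ := h.pad hjk
  refine ⟨{ Work := W, start := start, U := fun ch i => V ch i,
            readout := fun ch s => r ch s.1 s.2.2 }, fun ch H P => ?_⟩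
  rw [QuantumAdversary.prob, QuantumAdversary.state_eq_evolve,
    ← hF ch H fun x w c => if P (r ch x w) then ‖c‖ ^ 2 else 0]
  simp only [hV]
  rw [evolve_congr (V' := V ch)]
  · rfl
  · intro i hi
    have hi' : i ≤ k := hi
    simp [Fin.ofNat, Nat.mod_eq_of_lt (Nat.lt_succ_of_le hi')]

end Evolution

/-! ### The hybrid expansion -/

section Paths

variable {X Y W : Type u} [Fintype X] [DecidableEq X] [Fintype Y] [DecidableEq Y]
  [AddCommGroup Y] [Fintype W] [DecidableEq W] {Ch : Type v}

/-- A pattern `p : Fin n → Option Bool` treats the `i`-th query as described at `branch`.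
This is the number of queries at which the pattern `p` records the query input. -/
def recordings {n : ℕ} (p : Fin n → Option Bool) : ℕ :=
  ∑ i, if (p i).isSome then 1 else 0

/-- The sign of a single step of a pattern in the hybrid expansion. -/
def stepSign : Option Bool → ℂ
  | none => 1
  | some b => if b then 1 else -1

theorem recordings_snoc {n : ℕ} (p : Fin n → Option Bool) (a : Option Bool) :
    recordings (Fin.snoc p a : Fin (n + 1) → Option Bool) =
      recordings p + if a.isSome then 1 else 0 := by
  simp only [recordings, Fin.sum_univ_castSucc, Fin.snoc_castSucc, Fin.snoc_last]

theorem sum_pattern_succ {M : Type*} [AddCommMonoid M] {n : ℕ}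
    (f : (Fin (n + 1) → Option Bool) → M) :
    ∑ p, f p = ∑ p : Fin n → Option Bool,
      (f (Fin.snoc p none) + (f (Fin.snoc p (some true)) + f (Fin.snoc p (some false)))) := by
  rw [← (Fin.snocEquiv fun _ : Fin (n + 1) => Option Bool).sum_comp, Fintype.sum_prod_type_right]
  refine sum_congr rfl fun p _ => ?_
  rw [Fintype.sum_option, Fintype.sum_bool]
  rfl

/-- The generalization of `sum_choose_recordings_le` for which Pascal's rule closes the
induction on `q`. -/
theorem two_pow_mul_sum_choose_le (k q r : ℕ) :
    2 ^ r * ∑ p : Fin q → Option Bool, k.choose (r + recordings p) ≤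
      2 ^ k * (q + k).choose (q + r) := by
  induction q generalizing r with
  | zero =>
    simp only [univ_unique, sum_singleton, recordings, univ_eq_empty, sum_empty, zero_add, add_zero]
    rcases le_or_gt r k with h | h
    · exact Nat.mul_le_mul_right _ (Nat.pow_le_pow_right (by norm_num) h)
    · simp [Nat.choose_eq_zero_of_lt h]
  | succ q ih =>
    have h0 := ih r
    have h1 := ih (r + 1)
    have e : (q + 1 + k).choose (q + 1 + r) =
        (q + k).choose (q + r) + (q + k).choose (q + (r + 1)) := by
      rw [show q + 1 + k = q + k + 1 by ring, show q + 1 + r = q + r + 1 by ring,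
        Nat.choose_succ_succ']
      rfl
    rw [sum_pattern_succ, e]
    simp only [recordings_snoc, Option.isSome_none, Option.isSome_some, if_true, sum_add_distrib,
      Bool.false_eq_true, if_false, add_zero]
    have e2 : ∀ p : Fin q → Option Bool, r + (recordings p + 1) = r + 1 + recordings p :=
      fun p => by ring
    simp only [e2]
    rw [pow_succ] at h1
    linarith

theorem sum_choose_recordings_le (k q : ℕ) :
    ∑ p : Fin q → Option Bool, k.choose (recordings p) ≤ 2 ^ k * (q + k).choose k := by
  have h := two_pow_mul_sum_choose_le k q 0
  rw [add_zero, Nat.choose_symm_add] at h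
  simpa using h

/-- Up to sign, the contribution of the pattern `p` to the state after `n` queries, for an oracle
obtained from `H'` by substituting values of `H`; the set of recorded query inputs is `T`. At a
step `none` the query is answered from `T.piecewise H H'`. At a step `some b` it is projected to
the inputs outside the recorded set, the input is recorded, and the answer comes from `H` (for
`b = true`) or from `H'` (for `b = false`). -/
noncomputable def branch (V : ℕ → unitaryGroup (X × Y × W) ℂ) (ψ : X × Y × W → ℂ)
    (H H' : X → Y) : (n : ℕ) → (Fin n → Option Bool) → Finset X → X × Y × W → ℂ
  | 0, _, T => (V 0).1 *ᵥ if T = ∅ then ψ else 0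
  | n + 1, p, T => (V (n + 1)).1 *ᵥ
      match p (Fin.last n) with
      | none => oracleQuery (T.piecewise H H') (branch V ψ H H' n (Fin.init p) T)
      | some b => fun s => if s.1 ∈ T then
          oracleQuery (if b then H else H') (branch V ψ H H' n (Fin.init p) (T.erase s.1)) s
        else 0

theorem branch_eq_zero (V : ℕ → unitaryGroup (X × Y × W) ℂ) (ψ : X × Y × W → ℂ)
    (H H' : X → Y) {n : ℕ} (p : Fin n → Option Bool) (T : Finset X) (h : T.card ≠ recordings p) :
    branch V ψ H H' n p T = 0 := by
  induction n generalizing T with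
  | zero =>
    have : T ≠ ∅ := by
      rintro rfl
      simp [recordings] at h
    simp [branch, this]
  | succ n ih =>
    induction p using Fin.snocCases with | _ p a
    rw [recordings_snoc] at h
    rcases a with _ | b
    · simp [branch, ih p T (by simpa using h)]
      simp [oracleQuery, funext_iff, mulVec, dotProduct]
    · simp only [branch, Fin.snoc_last, Fin.init_snoc]
      convert mulVec_zero (V (n + 1)).1 using 2
      ext s
      by_cases hs : s.1 ∈ T
      · have hc := card_erase_add_one hs
        simp only [Option.isSome_some, if_true] at h
        rw [if_pos hs, ih p _ (by omega)]
        rfl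
      · rw [if_neg hs]
        rfl

omit [Fintype X] [Fintype Y] [DecidableEq Y] [AddCommGroup Y] in
/-- The correction turning answers from `T.piecewise H H'`, for all `T ⊆ S`, into answers from
`S.piecewise H H'`: each `T` that contains `x` collects what is missing at `T.erase x`. -/
theorem sum_powerset_telescope {M : Type*} [AddCommGroup M] (S : Finset X) (x : X)
    (H H' : X → Y) (f : Finset X → Y → M) :
    ∑ T ∈ S.powerset, f T (S.piecewise H H' x) =
      ∑ T ∈ S.powerset, f T (T.piecewise H H' x) +
        (∑ T ∈ S.powerset, (if x ∈ T then f (T.erase x) (H x) else 0) -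
          ∑ T ∈ S.powerset, (if x ∈ T then f (T.erase x) (H' x) else 0)) := by
  by_cases hx : x ∈ S
  · obtain ⟨S, hS, rfl⟩ : ∃ S', x ∉ S' ∧ insert x S' = S :=
      ⟨S.erase x, notMem_erase x S, insert_erase hx⟩
    have hT : ∀ T ∈ S.powerset, x ∉ T := fun T h hx => hS (mem_powerset.1 h hx)
    simp only [sum_powerset_insert hS]
    have e1 : ∑ T ∈ S.powerset, f T (T.piecewise H H' x) = ∑ T ∈ S.powerset, f T (H' x) :=
      sum_congr rfl fun T h => by rw [piecewise_eq_of_notMem _ _ _ (hT T h)]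
    have e2 : ∀ y, ∑ T ∈ S.powerset, (if x ∈ T then f (T.erase x) y else 0) = 0 :=
      fun y => sum_eq_zero fun T h => if_neg (hT T h)
    have e3 : ∀ y, ∑ T ∈ S.powerset,
        (if x ∈ insert x T then f ((insert x T).erase x) y else 0) = ∑ T ∈ S.powerset, f T y :=
      fun y => sum_congr rfl fun T h => by
        rw [if_pos (mem_insert_self x T), erase_insert (hT T h)]
    rw [e1, e2, e2, e3, e3]
    simp only [piecewise_eq_of_mem, mem_insert_self]
    abel
  · have hT : ∀ T ∈ S.powerset, x ∉ T := fun T h hx' => hx (mem_powerset.1 h hx')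
    rw [sum_eq_zero fun T h => if_neg (hT T h), sum_eq_zero fun T h => if_neg (hT T h), sub_zero,
      add_zero]
    exact sum_congr rfl fun T h => by
      rw [piecewise_eq_of_notMem _ _ _ hx, piecewise_eq_of_notMem _ _ _ (hT T h)]

/-- The hybrid expansion: the state for the oracle `S.piecewise H H'` is the signed sum of the
branches over all patterns and all sets `T ⊆ S` of recorded inputs. -/
theorem evolve_piecewise (V : ℕ → unitaryGroup (X × Y × W) ℂ) (ψ : X × Y × W → ℂ)
    (H H' : X → Y) (S : Finset X) (n : ℕ) :
    evolve V ψ (S.piecewise H H') n = ∑ p : Fin n → Option Bool, (∏ i, stepSign (p i)) •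
      ∑ T ∈ S.powerset, branch V ψ H H' n p T := by
  induction n with
  | zero =>
    simp only [univ_unique, sum_singleton, univ_eq_empty, prod_empty, one_smul, branch, evolve]
    rw [← mulVec_sum, sum_ite_eq', if_pos (empty_mem_powerset S)]
  | succ n ih =>
    rw [evolve, ih, sum_pattern_succ]
    simp only [branch, Fin.snoc_last, Fin.init_snoc, Fin.prod_univ_castSucc, Fin.snoc_castSucc,
      stepSign, ← mulVec_sum, ← mulVec_smul, ← mulVec_add]
    congr 1
    ext s
    obtain ⟨x, y, w⟩ := s
    simp only [oracleQuery, Finset.sum_apply, Pi.smul_apply, Pi.add_apply, smul_eq_mul, if_true,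
      Bool.false_eq_true, if_false, mul_one, mul_neg, neg_mul]
    refine sum_congr rfl fun p _ => ?_
    rw [sum_powerset_telescope S x H H' fun T z => branch V ψ H H' n p T (x, y - z, w)]
    ring

theorem norm_prod_stepSign {n : ℕ} (p : Fin n → Option Bool) : ‖∏ i, stepSign (p i)‖ = 1 := by
  rw [norm_prod]
  refine prod_eq_one fun i _ => ?_
  rcases p i with _ | _ | _ <;> simp [stepSign]

/-- The Cauchy-Schwarz inequality for the hybrid expansion. Only branches with
`T.card = recordings p` contribute, so only patterns with at most `k` recordings. -/
theorem norm_sq_evolve_piecewise_le (V : ℕ → unitaryGroup (X × Y × W) ℂ) (ψ : X × Y × W → ℂ)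
    (H H' : X → Y) (S : Finset X) {k : ℕ} (hS : S.card ≤ k) (q : ℕ) (s : X × Y × W) :
    ‖evolve V ψ (S.piecewise H H') q s‖ ^ 2 ≤ (2 ^ k * (q + k).choose k : ℝ) *
      ∑ p : Fin q → Option Bool with recordings p ≤ k,
        ∑ T with T.card = recordings p, ‖branch V ψ H H' q p T s‖ ^ 2 := by
  set Q : Finset (Σ _ : Fin q → Option Bool, Finset X) :=
    univ.sigma fun p => S.powersetCard (recordings p) with hQ
  have hcard : (Q.card : ℝ) ≤ 2 ^ k * (q + k).choose k := by
    have : Q.card ≤ 2 ^ k * (q + k).choose k := by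
      rw [hQ, card_sigma]
      refine le_trans (sum_le_sum fun p _ => ?_) (sum_choose_recordings_le k q)
      rw [card_powersetCard]
      exact Nat.choose_le_choose _ hS
    exact_mod_cast this
  calc ‖evolve V ψ (S.piecewise H H') q s‖ ^ 2
      ≤ (∑ t ∈ Q, ‖branch V ψ H H' q t.1 t.2 s‖) ^ 2 := by
        gcongr
        rw [evolve_piecewise, hQ, sum_sigma, Finset.sum_apply]
        refine (norm_sum_le _ _).trans (sum_le_sum fun p _ => ?_)
        rw [Pi.smul_apply, norm_smul, norm_prod_stepSign, one_mul, Finset.sum_apply]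
        refine (norm_sum_le _ _).trans_eq (sum_subset (fun T hT => ?_) fun T hT hT' => ?_).symm
        · exact mem_powerset.2 (mem_powersetCard.1 hT).1
        · rw [branch_eq_zero, Pi.zero_apply, norm_zero]
          exact fun h => hT' (mem_powersetCard.2 ⟨mem_powerset.1 hT, h⟩)
    _ ≤ Q.card * ∑ t ∈ Q, ‖branch V ψ H H' q t.1 t.2 s‖ ^ 2 := sq_sum_le_card_mul_sum_sq
    _ ≤ _ := by
        refine mul_le_mul hcard ?_ (sum_nonneg fun _ _ => by positivity) (by positivity)
        rw [hQ, sum_sigma]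
        rw [← sum_subset (subset_univ (univ.filter fun p : Fin q → Option Bool =>
          recordings p ≤ k))]
        · refine sum_le_sum fun p _ => sum_le_sum_of_subset_of_nonneg (fun T hT => ?_)
            fun _ _ _ => by positivity
          exact mem_filter.2 ⟨mem_univ _, (mem_powersetCard.1 hT).2⟩
        · intro p _ hp
          rw [powersetCard_eq_empty.2, sum_empty]
          simp only [mem_filter, mem_univ, true_and, not_le] at hp
          omega

end Paths

/-! ### The recording simulator -/

section Recording

variable {X Y W : Type u} [Fintype X] [DecidableEq X] [Fintype Y] [DecidableEq Y]
  [AddCommGroup Y] [Fintype W] [DecidableEq W] {Ch : Type v}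

/-- The work register of the recording simulator: the answer register and the work register of
the simulated circuit, the set of recorded inputs, and their recorded values. Its query register
is the one of the simulated circuit. -/
abbrev RecordWork (X Y W : Type u) : Type u := Y × W × Finset X × (X → Y)

instance : DecidableEq (RecordWork X Y W) :=
  inferInstanceAs (DecidableEq (Y × W × Finset X × (X → Y)))

/-- Application of `U` to the registers of the simulated circuit. -/
noncomputable def liftMulVec (U : unitaryGroup (X × Y × W) ℂ) (φ : X × Y × RecordWork X Y W → ℂ) :
    X × Y × RecordWork X Y W → ℂ :=
  fun (x, c, y, w, T, v) => (U.1 *ᵥ fun (x', y', w') => φ (x', c, y', w', T, v)) (x, y, w)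

/-- Separates the registers of the simulated circuit from those of the bookkeeping. -/
def recordEquiv (X Y W : Type u) :
    X × Y × RecordWork X Y W ≃ (X × Y × W) × (Y × Finset X × (X → Y)) where
  toFun := fun (x, c, y, w, T, v) => ((x, y, w), (c, T, v))
  invFun := fun ((x, y, w), (c, T, v)) => (x, c, y, w, T, v)
  left_inv _ := rfl
  right_inv _ := rfl

theorem Realizable.liftMulVec {k : ℕ} {Ψ : Ch → (X → Y) → X × Y × RecordWork X Y W → ℂ}
    (h : Realizable k Ψ) (U : Ch → unitaryGroup (X × Y × W) ℂ) :
    Realizable k fun ch H => liftMulVec (U ch) (Ψ ch H) := by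
  have hU : ∀ ch, (kroneckerMap (· * ·) (U ch).1
      (1 : Matrix (Y × Finset X × (X → Y)) (Y × Finset X × (X → Y)) ℂ)).submatrix
        (recordEquiv X Y W) (recordEquiv X Y W) ∈ unitaryGroup _ ℂ := fun ch => by
    rw [mem_unitaryGroup_iff, star_eq_conjTranspose, conjTranspose_submatrix,
      submatrix_mul_equiv, ← star_eq_conjTranspose,
      mem_unitaryGroup_iff.1 (kronecker_mem_unitary (U ch).2 (one_mem _)), submatrix_one_equiv]
  convert h.mulVec fun ch => ⟨_, hU ch⟩ using 3 with ch H
  ext s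
  rw [Matrix.mulVec, dotProduct, ← (recordEquiv X Y W).symm.sum_comp, Fintype.sum_prod_type]
  simp [QROM.liftMulVec, recordEquiv, Matrix.mulVec, dotProduct, Matrix.one_apply]

/-- Exchanges the answer register with the value stored for the query input. -/
def exchange (X Y W : Type u) [DecidableEq X] : Equiv.Perm (X × Y × RecordWork X Y W) where
  toFun := fun (x, c, y, w, T, v) => (x, v x, y, w, T, Function.update v x c)
  invFun := fun (x, c, y, w, T, v) => (x, v x, y, w, T, Function.update v x c)
  left_inv := fun (x, c, y, w, T, v) => by simp
  right_inv := fun (x, c, y, w, T, v) => by simp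

/-- Answers a query of the simulated circuit from the recorded values, completed by `H'`.
It maps to the basis state *before* the query. -/
def answerRecorded (W : Type u) (H' : X → Y) : Equiv.Perm (X × Y × RecordWork X Y W) where
  toFun := fun (x, c, y, w, T, v) => (x, c, y - T.piecewise v H' x, w, T, v)
  invFun := fun (x, c, y, w, T, v) => (x, c, y + T.piecewise v H' x, w, T, v)
  left_inv := fun (x, c, y, w, T, v) => by simp
  right_inv := fun (x, c, y, w, T, v) => by simp

/-- Toggles whether the query input is recorded, and answers the query by the value stored for it
or by `H'`. It maps to the basis state *before* the query. -/
def toggleAnswer (W : Type u) (H' : X → Y) (b : Bool) :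
    Equiv.Perm (X × Y × RecordWork X Y W) where
  toFun := fun (x, c, y, w, T, v) => (x, c, y - (if b then v else H') x, w, symmDiff T {x}, v)
  invFun := fun (x, c, y, w, T, v) => (x, c, y + (if b then v else H') x, w, symmDiff T {x}, v)
  left_inv := fun (x, c, y, w, T, v) => by simp
  right_inv := fun (x, c, y, w, T, v) => by simp

/-- The state of the recording simulator that follows the pattern `p`. At a step `none` it answers
from its record and `H'`, without a query of its own. At a step `some b` its one query, between two
exchanges, adds `H x` to the value stored for the query input `x`; then it toggles whether `x` is
recorded, and answers from the stored value or from `H'`. -/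
noncomputable def recordState (V : ℕ → unitaryGroup (X × Y × W) ℂ) (start : X × Y × W)
    (H H' : X → Y) : (n : ℕ) → (Fin n → Option Bool) → X × Y × RecordWork X Y W → ℂ
  | 0, _ => liftMulVec (V 0) (Pi.single (start.1, 0, start.2.1, start.2.2, ∅, 0) 1)
  | n + 1, p => liftMulVec (V (n + 1)) <|
      match p (Fin.last n) with
      | none => fun s => recordState V start H H' n (Fin.init p) (answerRecorded W H' s)
      | some b => fun s => oracleQuery H
          (fun t => recordState V start H H' n (Fin.init p) (exchange X Y W t))
          (exchange X Y W (toggleAnswer W H' b s))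

theorem realizable_recordState (V : Ch → ℕ → unitaryGroup (X × Y × W) ℂ) (start : X × Y × W)
    (H' : X → Y) {n : ℕ} (p : Fin n → Option Bool) :
    Realizable (recordings p) fun ch H => recordState (V ch) start H H' n p := by
  induction n with
  | zero => exact (realizable_single _).liftMulVec _
  | succ n ih =>
    induction p using Fin.snocCases with | _ p a
    rw [recordings_snoc]
    simp only [recordState, Fin.snoc_last, Fin.init_snoc]
    rcases a with _ | b
    · exact ((ih p).perm (answerRecorded W H')).liftMulVec fun ch => V ch (n + 1)
    · exact ((((ih p).perm (exchange X Y W)).query.perm (exchange X Y W)).perm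
        (toggleAnswer W H' b)).liftMulVec fun ch => V ch (n + 1)

omit [Fintype X] [Fintype Y] [DecidableEq Y] [Fintype W] [DecidableEq W] in
/-- A query between two exchanges adds `H x` to the value stored for `x`, and leaves the answer
register alone. -/
theorem oracleQuery_exchange (H : X → Y) (φ : X × Y × RecordWork X Y W → ℂ)
    (x : X) (c y : Y) (w : W) (T : Finset X) (v : X → Y) :
    oracleQuery H (fun t => φ (exchange X Y W t)) (exchange X Y W (x, c, y, w, T, v)) =
      φ (x, c, y, w, T, Function.update v x (v x - H x)) := by
  simp [oracleQuery, exchange]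

omit [Fintype X] in
theorem card_symmDiff_singleton (T : Finset X) (x : X) :
    T.card ≤ (symmDiff T {x}).card + 1 := by
  have h : T ⊆ insert x (symmDiff T {x}) := fun t ht => by
    by_cases hx : t = x <;> simp [mem_symmDiff, ht, hx]
  exact (card_le_card h).trans (card_insert_le _ _)

/-- At most one input is recorded per recording step. This holds for arbitrary stored values, which
are not those of `H` at the inputs that have been toggled twice. -/
theorem recordState_eq_zero (V : ℕ → unitaryGroup (X × Y × W) ℂ) (start : X × Y × W)
    (H H' : X → Y) {n : ℕ} (p : Fin n → Option Bool) {T : Finset X} (hT : recordings p < T.card)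
    (x : X) (c y : Y) (w : W) (v : X → Y) :
    recordState V start H H' n p (x, c, y, w, T, v) = 0 := by
  have h0 : ∀ U : unitaryGroup (X × Y × W) ℂ, ∀ s, (U.1 *ᵥ fun (_, _, _) => 0) s = 0 :=
    fun U s => congrFun (mulVec_zero U.1) s
  induction n generalizing T x c y w v with
  | zero =>
    have hne : T ≠ ∅ := by
      rintro rfl
      simp at hT
    simp [recordState, liftMulVec, hne, h0]
  | succ n ih =>
    induction p using Fin.snocCases with | _ p a
    rw [recordings_snoc] at hT
    simp only [recordState, Fin.snoc_last, Fin.init_snoc, liftMulVec]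
    rcases a with _ | b
    · simp only [answerRecorded, Equiv.coe_fn_mk]
      simp only [ih p (by simpa using hT), h0]
    · simp only [toggleAnswer, Equiv.coe_fn_mk, oracleQuery_exchange]
      have hc : ∀ x', recordings p < (symmDiff T {x'}).card := fun x' => by
        have := card_symmDiff_singleton T x'
        simp only [Option.isSome_some, if_true] at hT
        omega
      simp only [ih p (hc _), h0]

/-- Where the record has the full size, the amplitudes of the simulator are those of the branch. The
stored values vanish outside `T`, and the answer register is back to `0`. -/
theorem recordState_eq_branch (V : ℕ → unitaryGroup (X × Y × W) ℂ) (start : X × Y × W)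
    (H H' : X → Y) {n : ℕ} (p : Fin n → Option Bool) {T : Finset X} (hT : recordings p ≤ T.card)
    (x y w) : recordState V start H H' n p (x, 0, y, w, T, T.piecewise H 0) =
      branch V (Pi.single start 1) H H' n p T (x, y, w) := by
  induction n generalizing T x y w with
  | zero =>
    simp only [recordState, liftMulVec, branch]
    congr 2
    ext ⟨x', y', w'⟩
    obtain ⟨x₀, y₀, w₀⟩ := start
    rcases eq_or_ne T ∅ with rfl | hne
    · simp [Pi.single_apply]
    · simp [hne]
  | succ n ih =>
    induction p using Fin.snocCases with | _ p a
    rw [recordings_snoc] at hT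
    simp only [recordState, Fin.snoc_last, Fin.init_snoc, liftMulVec, branch]
    congr 2
    ext ⟨x', y', w'⟩
    rcases a with _ | b
    · simp only [answerRecorded, Equiv.coe_fn_mk, oracleQuery]
      rw [ih p (by simpa using hT)]
      congr 3
      by_cases hx : x' ∈ T <;> simp [hx]
    · simp only [Option.isSome_some, if_true] at hT
      simp only [toggleAnswer, Equiv.coe_fn_mk, oracleQuery_exchange]
      by_cases hx : x' ∈ T
      · have e : symmDiff T {x'} = T.erase x' := by
          ext t
          by_cases ht : t = x' <;> simp [mem_symmDiff, ht, hx]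
        have e2 : Function.update (T.piecewise H 0) x' (T.piecewise H 0 x' - H x') =
            (T.erase x').piecewise H 0 := by
          ext t
          by_cases ht : t = x'
          · subst ht
            simp [hx]
          · by_cases htT : t ∈ T <;> simp [ht, htT]
        have hc := card_erase_add_one hx
        rw [e, e2, ih p (by omega), if_pos hx]
        simp only [oracleQuery]
        congr 3
        cases b <;> simp [hx]
      · -- The input `x'` would have been removed from a set with too many elements.
        rw [if_neg hx]
        refine recordState_eq_zero V start H H' p ?_ _ _ _ _ _
        have e : symmDiff T {x'} = insert x' T := by
          ext t
          by_cases ht : t = x' <;> simp [mem_symmDiff, ht, hx]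
        rw [e, card_insert_of_notMem hx]
        omega

open Classical in
/-- For each fake oracle `H'` and each pattern with at most `k` recordings there is a `k`-query
adversary whose output distribution dominates the squared branches of the pattern. -/
theorem exists_recording_adversary {Out : Type w} {k q : ℕ} (A : QuantumAdversary X Y Ch Out q)
    (H' : X → Y) {p : Fin q → Option Bool} (hp : recordings p ≤ k) :
    ∃ B : QuantumAdversary X Y Ch Out k, ∀ ch H P,
      ∑ s : X × Y × A.Work, (if P (A.readout ch s) then ∑ T with T.card = recordings p,
        ‖branch (fun n => A.U ch (Fin.ofNat (q + 1) n)) (Pi.single A.start 1) H H' q p T s‖ ^ 2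
        else 0) ≤ B.prob ch H P := by
  obtain ⟨B, hB⟩ := (realizable_recordState
    (fun ch n => A.U ch (Fin.ofNat (q + 1) n)) A.start H' p).exists_adversary hp
      (fun ch x (w : RecordWork X Y A.Work) => A.readout ch (x, w.1, w.2.1))
  refine ⟨B, fun ch H P => ?_⟩
  rw [hB]
  set ι : (X × Y × A.Work) × Finset X → X × Y × RecordWork X Y A.Work :=
    fun t => (t.1.1, 0, t.1.2.1, t.1.2.2, t.2, t.2.piecewise H 0) with hι
  have hinj : Function.Injective ι := by
    rintro ⟨⟨x, y, w⟩, T⟩ ⟨⟨x', y', w'⟩, T'⟩ h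
    simp only [hι, Prod.mk.injEq] at h ⊢
    tauto
  refine le_trans ?_ (sum_le_univ_sum_of_nonneg (s := (univ ×ˢ
    univ.filter fun T : Finset X => T.card = recordings p).image ι)
      fun s => by split_ifs <;> positivity)
  rw [sum_image hinj.injOn, sum_product]
  refine sum_le_sum fun s _ => ?_
  split_ifs with h
  · refine sum_le_sum fun T hT => ?_
    rw [recordState_eq_branch _ _ _ _ _ (mem_filter.1 hT).2.ge]
  · simp

end Recording

/-! ### Averaging over oracles -/

section Averaging

variable {X Y : Type u} [Fintype X] [DecidableEq X] [Fintype Y] [DecidableEq Y]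
  [AddCommGroup Y] {Ch : Type v}

omit [DecidableEq Y] [AddCommGroup Y] in
/-- Substituting values of one uniformly random oracle into another gives a uniformly random
oracle. -/
theorem sum_sum_piecewise (S : Finset X) (F : (X → Y) → ℝ) :
    ∑ H : X → Y, ∑ H' : X → Y, F (S.piecewise H H') = Fintype.card (X → Y) * ∑ H, F H := by
  -- Exchanging the values on `S` is a bijection on pairs of oracles.
  let e : Equiv.Perm ((X → Y) × (X → Y)) :=
    Function.Involutive.toPerm (fun t => (S.piecewise t.1 t.2, S.piecewise t.2 t.1)) fun t => by
      ext x <;> by_cases hx : x ∈ S <;> simp [hx]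
  rw [← Fintype.sum_prod_type']
  refine (Equiv.sum_comp e fun t : (X → Y) × (X → Y) => F t.1).trans ?_
  rw [Fintype.sum_prod_type_right]
  simp

open Classical in
/-- The bound for a fixed challenge: the simulators `B (H', p)` together win at least as often as
`A`, up to the number of branches. -/
theorem card_mul_sum_prob_le {Z : Type w} {k q : ℕ} (G : SearchGame X Y Ch Z k)
    (A : QuantumAdversary X Y Ch ((Fin k → X) × Z) q)
    (B : (X → Y) × {p : Fin q → Option Bool // recordings p ≤ k} →
      QuantumAdversary X Y Ch ((Fin k → X) × Z) k)
    (hB : ∀ t ch H P, ∑ s : X × Y × A.Work, (if P (A.readout ch s) then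
      ∑ T with T.card = recordings t.2.1, ‖branch (fun n => A.U ch (Fin.ofNat (q + 1) n))
        (Pi.single A.start 1) H t.1 q t.2 T s‖ ^ 2 else 0) ≤ (B t).prob ch H P) (ch : Ch) :
    Fintype.card (X → Y) * ∑ H, A.prob ch H (fun o => G.rel ch o.1 (fun i => H (o.1 i)) o.2) ≤
      (2 ^ k * (q + k).choose k : ℝ) * ∑ t, ∑ H,
        (B t).prob ch H (fun o => G.rel ch o.1 (fun i => H (o.1 i)) o.2) := by
  set V : ℕ → unitaryGroup (X × Y × A.Work) ℂ := fun n => A.U ch (Fin.ofNat (q + 1) n)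
  set ψ : X × Y × A.Work → ℂ := Pi.single A.start 1
  set N : ℝ := 2 ^ k * (q + k).choose k
  set win : (X → Y) → X × Y × A.Work → Prop := fun H s =>
    G.rel ch (A.readout ch s).1 (fun i => H ((A.readout ch s).1 i)) (A.readout ch s).2
  set S : X × Y × A.Work → Finset X := fun s => univ.image (A.readout ch s).1
  have hwin : ∀ s H H', win ((S s).piecewise H H') s ↔ win H s := fun s H H' => by
    have : ∀ i, (S s).piecewise H H' ((A.readout ch s).1 i) = H ((A.readout ch s).1 i) :=
      fun i => piecewise_eq_of_mem _ _ _ (mem_image_of_mem _ (mem_univ i))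
    simp only [win, this]
  have hS : ∀ s, (S s).card ≤ k := fun s => card_image_le.trans (by simp)
  have hbound : ∀ H H' s,
      (if win ((S s).piecewise H H') s then
        ‖evolve V ψ ((S s).piecewise H H') q s‖ ^ 2 else 0) ≤
      N * ∑ p : {p : Fin q → Option Bool // recordings p ≤ k}, if win H s then
        ∑ T with T.card = recordings p.1, ‖branch V ψ H H' q p T s‖ ^ 2 else 0 := by
    intro H H' s
    simp only [hwin]
    split_ifs
    · refine (norm_sq_evolve_piecewise_le V ψ H H' (S s) (hS s) q s).trans_eq ?_
      congr 1
      exact sum_subtype _ (by simp) _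
    · simp
  calc Fintype.card (X → Y) * ∑ H, A.prob ch H (fun o => G.rel ch o.1 (fun i => H (o.1 i)) o.2)
      = ∑ s, Fintype.card (X → Y) *
          ∑ H, if win H s then ‖evolve V ψ H q s‖ ^ 2 else 0 := by
        rw [← mul_sum, sum_comm]
        congr 1
        refine sum_congr rfl fun H _ => ?_
        rw [QuantumAdversary.prob, A.state_eq_evolve]
        rfl
    _ = ∑ s, ∑ H, ∑ H', if win ((S s).piecewise H H') s then
          ‖evolve V ψ ((S s).piecewise H H') q s‖ ^ 2 else 0 :=
        sum_congr rfl fun s _ => (sum_sum_piecewise (S s)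
          fun H => if win H s then ‖evolve V ψ H q s‖ ^ 2 else 0).symm
    _ ≤ ∑ s, ∑ H, ∑ H', N * ∑ p : {p : Fin q → Option Bool // recordings p ≤ k},
          if win H s then
            ∑ T with T.card = recordings p.1, ‖branch V ψ H H' q p T s‖ ^ 2 else 0 :=
        sum_le_sum fun s _ => sum_le_sum fun H _ => sum_le_sum fun H' _ => hbound H H' s
    _ = N * ∑ t : (X → Y) × {p : Fin q → Option Bool // recordings p ≤ k}, ∑ H, ∑ s,
          if win H s then
            ∑ T with T.card = recordings t.2.1, ‖branch V ψ H t.1 q t.2 T s‖ ^ 2 else 0 := by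
        simp only [← mul_sum]
        congr 1
        refine (sum_comm.trans (sum_congr rfl fun H _ => sum_comm.trans
          (sum_congr rfl fun H' _ => sum_comm))).trans ?_
        refine Eq.trans ?_ (Fintype.sum_prod_type _).symm
        exact sum_comm.trans (sum_congr rfl fun H' _ => sum_comm)
    _ ≤ _ := by
        refine mul_le_mul_of_nonneg_left (sum_le_sum fun t _ => sum_le_sum fun H _ => ?_)
          (by positivity)
        exact hB t ch H fun o => G.rel ch o.1 (fun i => H (o.1 i)) o.2

theorem SearchGame.hasSum_winProb {Z : Type w} {k q : ℕ} (G : SearchGame X Y Ch Z k)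
    (A : QuantumAdversary X Y Ch ((Fin k → X) × Z) q) :
    HasSum (fun ch => (G.challenge ch).toReal * ∑ H : X → Y,
      A.prob ch H (fun o => G.rel ch o.1 (fun i => H (o.1 i)) o.2))
      (Fintype.card (X → Y) * G.winProb A) := by
  have hs : ∀ H : X → Y, Summable fun ch => (G.challenge ch).toReal *
      A.prob ch H (fun o => G.rel ch o.1 (fun i => H (o.1 i)) o.2) := fun H =>
    Summable.of_nonneg_of_le (fun ch => mul_nonneg ENNReal.toReal_nonneg (A.prob_nonneg _ _ _))
      (fun ch => mul_le_of_le_one_right ENNReal.toReal_nonneg (A.prob_le_one _ _ _))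
      (ENNReal.summable_toReal G.challenge.tsum_coe_ne_top)
  have hne : (Fintype.card (X → Y) : ℝ) ≠ 0 := Nat.cast_ne_zero.2 Fintype.card_ne_zero
  rw [SearchGame.winProb, mul_inv_cancel_left₀ hne]
  simpa only [mul_sum] using hasSum_sum fun H _ => (hs H).hasSum

end Averaging

end QROM

theorem theorem4p1 {X Y : Type u} {Ch : Type v} {Z : Type w}
    [Fintype X] [DecidableEq X] [Fintype Y] [DecidableEq Y] [AddCommGroup Y]
    (k q : ℕ) (G : QROM.SearchGame X Y Ch Z k)
    (A : QROM.QuantumAdversary X Y Ch ((Fin k → X) × Z) q) :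
    ∃ B : QROM.QuantumAdversary X Y Ch ((Fin k → X) × Z) k,
      G.winProb B ≥
        (1 / ((2 : ℝ) ^ (2 * k) * ((q + k).choose k : ℝ) ^ 2)) * G.winProb A := by
  classical
  choose B hB using fun t : (X → Y) × {p : Fin q → Option Bool // QROM.recordings p ≤ k} =>
    QROM.exists_recording_adversary A t.1 t.2.2
  set N : ℝ := 2 ^ k * (q + k).choose k with hN
  have hN0 : 0 < N := by
    have := Nat.choose_pos (Nat.le_add_left k q)
    positivity
  have hc : (0 : ℝ) < Fintype.card (X → Y) := Nat.cast_pos.2 Fintype.card_pos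
  -- The sum over the challenges of the bounds for a fixed challenge.
  have hsum : Fintype.card (X → Y) * G.winProb A ≤ N * ∑ t, G.winProb (B t) := by
    have h := hasSum_le
      (fun ch => mul_le_mul_of_nonneg_left (QROM.card_mul_sum_prob_le G A B hB ch)
        (ENNReal.toReal_nonneg (a := G.challenge ch)))
      (by simpa only [mul_left_comm] using
        (G.hasSum_winProb A).mul_left (Fintype.card (X → Y) : ℝ))
      (by simpa only [mul_left_comm, Finset.mul_sum] using
        (hasSum_sum fun t (_ : t ∈ Finset.univ) => G.hasSum_winProb (B t)).mul_left N)
    rw [← Finset.mul_sum, ← Finset.mul_sum] at h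
    refine le_of_mul_le_mul_left (h.trans_eq ?_) hc
    ring
  have hA : 0 ≤ G.winProb A := by
    refine nonneg_of_mul_nonneg_right ((G.hasSum_winProb A).nonneg fun ch => ?_) hc
    exact mul_nonneg ENNReal.toReal_nonneg (Finset.sum_nonneg fun H _ => A.prob_nonneg _ _ _)
  have hpat : (Fintype.card {p : Fin q → Option Bool // QROM.recordings p ≤ k} : ℝ) ≤ N := by
    have : Fintype.card {p : Fin q → Option Bool // QROM.recordings p ≤ k} ≤
        2 ^ k * (q + k).choose k := by
      rw [Fintype.card_subtype, Finset.card_eq_sum_ones, Finset.sum_filter]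
      refine le_trans (Finset.sum_le_sum fun p _ => ?_) (QROM.sum_choose_recordings_le k q)
      split_ifs with h
      · exact Nat.choose_pos h
      · exact Nat.zero_le _
    rw [hN]
    exact_mod_cast this
  have hne : (Finset.univ : Finset
      ((X → Y) × {p : Fin q → Option Bool // QROM.recordings p ≤ k})).Nonempty :=
    ⟨(0, ⟨fun _ => none, by simp [QROM.recordings]⟩), Finset.mem_univ _⟩
  obtain ⟨t, -, ht⟩ := Finset.exists_le_of_sum_le hne
    (f := fun _ => 1 / N ^ 2 * G.winProb A) (g := fun t => G.winProb (B t)) (by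
      rw [Finset.sum_const, Finset.card_univ, Fintype.card_prod, nsmul_eq_mul, Nat.cast_mul]
      calc (Fintype.card (X → Y) : ℝ) * _ * (1 / N ^ 2 * G.winProb A)
          ≤ Fintype.card (X → Y) * N * (1 / N ^ 2 * G.winProb A) := by gcongr
        _ = N⁻¹ * (Fintype.card (X → Y) * G.winProb A) := by field_simp
        _ ≤ N⁻¹ * (N * ∑ t, G.winProb (B t)) := by gcongr
        _ = _ := inv_mul_cancel_left₀ hN0.ne' _)
  refine ⟨B t, ?_⟩
  have e : (2 : ℝ) ^ (2 * k) * ((q + k).choose k : ℝ) ^ 2 = N ^ 2 := by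
    rw [hN, mul_pow, ← pow_mul, mul_comm k 2]
  rw [e]
  exact ht
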